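/- Let $k$ be an algebraically closed field of characteristic $0$, let $u,v$ be independent transcendentals over $k$, and let $a,b$ be elements of a field extension of $k(u,v)$ with $ab=u$ and $b^3=v$. Put $$F(X)=X^3+aX^2+bX+1,\qquad G(X)=4X^3+b^2X^2+2bX+1 .$$ For a sextic $f=c_6\prod_{i=1}^6(X-x_i)$, with $(ij):=x_i-x_j$, let $$J_2=c_6^2\sum_{15}(12)^2(34)^2(56)^2,\qquad J_4=c_6^4\sum_{10}(12)^2(23)^2(31)^2(45)^2(56)^2(64)^2,$$ $$J_6=c_6^6\sum_{60}(12)^2(23)^2(31)^2(45)^2(56)^2(64)^2(14)^2(25)^2(36)^2,\qquad J_{10}=c_6^{10}\prod_{i<j}(ij)^2$$ be its Igusa--Clebsch invariants (each sum runs over the distinct terms obtained from the displayed one by permuting the roots; all four are integer polynomials in the coefficients of $f$), and let $$i_1=144\,\frac{J_4}{J_2^2},\qquad i_2=-1728\,\frac{J_2J_4-3J_6}{J_2^3},\qquad i_3=486\,\frac{J_{10}}{J_2^5}$$ be its absolute invariants, evaluated at $f=FG$. For two cubics $F=\sum a_iX^i$, $G=\sum b_iX^i$ let $H(F,G)=a_3b_0-\tfrac13a_2b_1+\tfrac13a_1b_2-a_0b_3$,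 let $R(F,G)$ be their resultant and $D$ the discriminant of a cubic, and put $$r_1=\frac{H(F,G)^3}{R(F,G)},\qquad r_2=\frac{H(F,G)^4}{D(F)D(G)} ,$$ evaluated at the cubics $F,G$ above. Then $J_2(FG)$, $R(F,G)$, $D(F)$, $D(G)$ are nonzero, the elements $i_1,i_2,i_3,r_1,r_2$ lie in $k(u,v)$, and $$k(i_1,i_2,i_3)=k(r_1,r_2).$$ Moreover $k(u,v)/k(r_1,r_2)$ is a Galois extension of degree $2$ whose Galois group is generated by the involution $\nu$ with $$\nu(u)=\frac{(v-3u)(324u^2+15u^2v-378uv-4uv^2+243v+72v^2)}{(v-27)(4u^3+27v-18uv-u^2v+4v^2)},\qquad \nu(v)=-\frac{4(v-3u)^3}{4u^3+27v-18uv-u^2v+4v^2}.$$ -/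

import Mathlib

open Polynomial

noncomputable section

variable {K : Type*} [Field K]

/-! Invariants of a binary sextic `f = c6 X^6 + ... + c1 X + c0`, in the Igusa-Clebsch
normalisation and expanded in the coefficients. Writing `f = c6 * ∏ (X - x i)` and `(ij)` for
`x i - x j`, they are the usual symmetric functions of the roots recalled below. -/

/-- `J₂ = c6^2 * ∑ (12)^2 (34)^2 (56)^2`, 15 terms. -/
def sexticJ2 (f : K[X]) : K :=
  let c0 := f.coeff 0
  let c1 := f.coeff 1
  let c2 := f.coeff 2
  let c3 := f.coeff 3
  let c4 := f.coeff 4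
  let c5 := f.coeff 5
  let c6 := f.coeff 6
  6 * c3 ^ 2 - 16 * c2 * c4 + 40 * c1 * c5 - 240 * c0 * c6

/-- `J₄ = c6^4 * ∑ (12)^2 (23)^2 (31)^2 (45)^2 (56)^2 (64)^2`, 10 terms. -/
def sexticJ4 (f : K[X]) : K :=
  let c0 := f.coeff 0
  let c1 := f.coeff 1
  let c2 := f.coeff 2
  let c3 := f.coeff 3
  let c4 := f.coeff 4
  let c5 := f.coeff 5
  let c6 := f.coeff 6
  4 * c2 ^ 2 * c4 ^ 2 - 12 * c2 ^ 2 * c3 * c5 + 48 * c2 ^ 3 * c6 - 12 * c1 * c3 * c4 ^ 2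
   + 36 * c1 * c3 ^ 2 * c5 + 4 * c1 * c2 * c4 * c5 - 180 * c1 * c2 * c3 * c6
   - 80 * c1 ^ 2 * c5 ^ 2 + 300 * c1 ^ 2 * c4 * c6 + 48 * c0 * c4 ^ 3 - 180 * c0 * c3 * c4 * c5
   + 324 * c0 * c3 ^ 2 * c6 + 300 * c0 * c2 * c5 ^ 2 - 504 * c0 * c2 * c4 * c6
   - 540 * c0 * c1 * c5 * c6 + 1620 * c0 ^ 2 * c6 ^ 2

/-- `J₆ = c6^6 * ∑ (12)^2 (23)^2 (31)^2 (45)^2 (56)^2 (64)^2 (14)^2 (25)^2 (36)^2`, 60 terms. -/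
def sexticJ6 (f : K[X]) : K :=
  let c0 := f.coeff 0
  let c1 := f.coeff 1
  let c2 := f.coeff 2
  let c3 := f.coeff 3
  let c4 := f.coeff 4
  let c5 := f.coeff 5
  let c6 := f.coeff 6
  8 * c2 ^ 2 * c3 ^ 2 * c4 ^ 2 - 24 * c2 ^ 2 * c3 ^ 3 * c5 - 24 * c2 ^ 3 * c4 ^ 3
   + 76 * c2 ^ 3 * c3 * c4 * c5 + 60 * c2 ^ 3 * c3 ^ 2 * c6 - 36 * c2 ^ 4 * c5 ^ 2
   - 160 * c2 ^ 4 * c4 * c6 - 24 * c1 * c3 ^ 3 * c4 ^ 2 + 72 * c1 * c3 ^ 4 * c5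
   + 76 * c1 * c2 * c3 * c4 ^ 3 - 238 * c1 * c2 * c3 ^ 2 * c4 * c5 - 198 * c1 * c2 * c3 ^ 3 * c6
   + 28 * c1 * c2 ^ 2 * c4 ^ 2 * c5 + 26 * c1 * c2 ^ 2 * c3 * c5 ^ 2
   + 492 * c1 * c2 ^ 2 * c3 * c4 * c6 + 616 * c1 * c2 ^ 3 * c5 * c6 - 36 * c1 ^ 2 * c4 ^ 4
   + 26 * c1 ^ 2 * c3 * c4 ^ 2 * c5 + 176 * c1 ^ 2 * c3 ^ 2 * c5 ^ 2
   + 330 * c1 ^ 2 * c3 ^ 2 * c4 * c6 + 64 * c1 ^ 2 * c2 * c4 * c5 ^ 2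
   - 640 * c1 ^ 2 * c2 * c4 ^ 2 * c6 - 1860 * c1 ^ 2 * c2 * c3 * c5 * c6
   - 900 * c1 ^ 2 * c2 ^ 2 * c6 ^ 2 - 320 * c1 ^ 3 * c5 ^ 3 + 1600 * c1 ^ 3 * c4 * c5 * c6
   + 2250 * c1 ^ 3 * c3 * c6 ^ 2 + 60 * c0 * c3 ^ 2 * c4 ^ 3 - 198 * c0 * c3 ^ 3 * c4 * c5
   + 162 * c0 * c3 ^ 4 * c6 - 160 * c0 * c2 * c4 ^ 4 + 492 * c0 * c2 * c3 * c4 ^ 2 * c5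
   + 330 * c0 * c2 * c3 ^ 2 * c5 ^ 2 - 468 * c0 * c2 * c3 ^ 2 * c4 * c6
   - 640 * c0 * c2 ^ 2 * c4 * c5 ^ 2 + 424 * c0 * c2 ^ 2 * c4 ^ 2 * c6
   - 876 * c0 * c2 ^ 2 * c3 * c5 * c6 - 96 * c0 * c2 ^ 3 * c6 ^ 2 + 616 * c0 * c1 * c4 ^ 3 * c5
   - 1860 * c0 * c1 * c3 * c4 * c5 ^ 2 - 876 * c0 * c1 * c3 * c4 ^ 2 * c6
   + 1818 * c0 * c1 * c3 ^ 2 * c5 * c6 + 1600 * c0 * c1 * c2 * c5 ^ 3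
   + 3472 * c0 * c1 * c2 * c4 * c5 * c6 + 3060 * c0 * c1 * c2 * c3 * c6 ^ 2
   - 2240 * c0 * c1 ^ 2 * c5 ^ 2 * c6 - 18600 * c0 * c1 ^ 2 * c4 * c6 ^ 2
   - 900 * c0 ^ 2 * c4 ^ 2 * c5 ^ 2 - 96 * c0 ^ 2 * c4 ^ 3 * c6 + 2250 * c0 ^ 2 * c3 * c5 ^ 3
   + 3060 * c0 ^ 2 * c3 * c4 * c5 * c6 - 10044 * c0 ^ 2 * c3 ^ 2 * c6 ^ 2
   - 18600 * c0 ^ 2 * c2 * c5 ^ 2 * c6 + 20664 * c0 ^ 2 * c2 * c4 * c6 ^ 2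
   + 59940 * c0 ^ 2 * c1 * c5 * c6 ^ 2 - 119880 * c0 ^ 3 * c6 ^ 3

/-- `J₁₀` is the discriminant of the sextic. -/
def sexticJ10 (f : K[X]) : K := f.discr

/-- The absolute invariant `i₁ = 144 J₄ / J₂²`. -/
def absInv1 (f : K[X]) : K := 144 * sexticJ4 f / sexticJ2 f ^ 2

/-- The absolute invariant `i₂ = -1728 (J₂ J₄ - 3 J₆) / J₂³`. -/
def absInv2 (f : K[X]) : K :=
  -1728 * (sexticJ2 f * sexticJ4 f - 3 * sexticJ6 f) / sexticJ2 f ^ 3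

/-- The absolute invariant `i₃ = 486 J₁₀ / J₂⁵`. -/
def absInv3 (f : K[X]) : K := 486 * sexticJ10 f / sexticJ2 f ^ 5

/-- The joint invariant `H(F, G)` of two cubics. -/
def cubicH (F G : K[X]) : K :=
  F.coeff 3 * G.coeff 0 - 1 / 3 * F.coeff 2 * G.coeff 1
    + 1 / 3 * F.coeff 1 * G.coeff 2 - F.coeff 0 * G.coeff 3

/-- `r₁(F, G) = H(F, G)³ / R(F, G)`, with `R` the resultant of the two cubics. -/
def cubicR1 (F G : K[X]) : K := cubicH F G ^ 3 / resultant F G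

/-- `r₂(F, G) = H(F, G)⁴ / (D(F) D(G))`, with `D` the discriminant of a cubic. -/
def cubicR2 (F G : K[X]) : K := cubicH F G ^ 4 / (F.discr * G.discr)

/-- The cubic `F = X³ + a X² + b X + 1`. -/
def cubicF (a b : K) : K[X] := X ^ 3 + C a * X ^ 2 + C b * X + 1

/-- The cubic `G = 4 X³ + b² X² + 2 b X + 1`. -/
def cubicG (b : K) : K[X] := C 4 * X ^ 3 + C (b ^ 2) * X ^ 2 + C (2 * b) * X + 1

/-- The image of `u` under the involution `ν`. -/
def nuU (u v : K) : K :=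
  (v - 3 * u) * (324 * u ^ 2 + 15 * u ^ 2 * v - 378 * u * v - 4 * u * v ^ 2 + 243 * v
      + 72 * v ^ 2)
    / ((v - 27) * (4 * u ^ 3 + 27 * v - 18 * u * v - u ^ 2 * v + 4 * v ^ 2))

/-- The image of `v` under the involution `ν`. -/
def nuV (u v : K) : K :=
  -(4 * (v - 3 * u) ^ 3) / (4 * u ^ 3 + 27 * v - 18 * u * v - u ^ 2 * v + 4 * v ^ 2)

variable (k : Type*) [Field k] [Algebra k K]

/-- The subfield `k(u, v)` of `K`. -/
abbrev fieldUV (u v : K) : IntermediateField k K := IntermediateField.adjoin k {u, v}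

/-- The element `u` of `k(u, v)`. -/
def genU (u v : K) : fieldUV k u v := ⟨u, IntermediateField.subset_adjoin k _ (by simp)⟩

/-- The element `v` of `k(u, v)`. -/
def genV (u v : K) : fieldUV k u v := ⟨v, IntermediateField.subset_adjoin k _ (by simp)⟩

/-- The subfield `k(i₁, i₂, i₃)` generated by the absolute invariants of a sextic. -/
abbrev fieldI (f : K[X]) : IntermediateField k K :=
  IntermediateField.adjoin k {absInv1 f, absInv2 f, absInv3 f}

/-- The subfield `k(r₁, r₂)` generated by the invariants of two cubics. -/
abbrev fieldR (F G : K[X]) : IntermediateField k K :=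
  IntermediateField.adjoin k {cubicR1 F G, cubicR2 F G}

end

/-!
Put `w = v - 27`, `m = (u - 9) / w` and `t = L / (w v)` with
`L = m ^ 2 (4 m - 1) w + (9 m - 2) ^ 2`. In these coordinates, which come from `H(F, G) / D(G)` and
from the cusp of `D(F) = 0` at `(u, v) = (9, 27)`, all invariants become short: `w` only enters
through the weight, and with `q = 4 m ^ 2 - 12 m + 3`, `A = m ^ 4 - 3 (2 m + 3) t` and
`B = 2 m ^ 6 - 18 m ^ 3 t + 81 m ^ 2 t + 27 t ^ 2`,

* `J₂ = 2 w ^ 2 q`, `J₄ = 4 w ^ 4 A`, `J₂ J₄ - 3 J₆ = 4 w ^ 6 B`, `J₁₀ = -16 w ^ 10 t ^ 3`;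
* `R(F, G) = D(F) = -w ^ 3 t`, `D(G) = 16 w`, `H(F, G) = w (1 - 2 m) / 3`.

Hence `r₁ = -(1 - 2 m) ^ 3 / (27 t)` and `r₂ = r₁ (1 - 2 m) / 48`, so that `k(r₁, r₂) = k(m, t)`
(`fieldR_eq_adjoin`), and `k(i₁, i₂, i₃)` is generated by `A / q ^ 2`, `B / q ^ 3`, `t ^ 3 / q ^ 5`.

That these three elements generate `k(m, t)` is the harder half (`mem_adjoin_absInv`). As `A` is
linear in `t`, eliminating `t` leaves two polynomials in one variable over `k(i₁, i₂, i₃)`, of degrees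
8 and 13, with the common root `m`. They have no other common factor, since their resultant, after
division of the first by `X - m`, is a polynomial in `m`, `t` that does not vanish at
`(m, t) = (-1, 1/3)`; there `A = 0`, and the absence of further common roots is checked by hand
(`isCoprime_specialization`). So the minimal polynomial of `m` over `k(i₁, i₂, i₃)` is linear.

Finally `k(u, v) = k(m, t)(w)`, and the definition of `t` is a quadratic equation for `w` over
`k(m, t)` whose second root is `-(9 m - 2) ^ 2 / (t w)`. Written in `u` and `v`, replacing `w` by that
root is the map `(nuU, nuV)`. The pair `(nuU, nuV)` is algebraically independent because `k(u, v)` is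
algebraic over the field it generates, so the map extends to an endomorphism of `k(u, v)`, which
fixes `m` and `t` and moves `w`; therefore the degree is exactly two (`exists_galois_involution`).
-/

/-! ### The two cubics, their discriminants and their resultant -/

/-- The discriminant of a product, from `(fg)' = f'g + fg'` and the multiplicativity of the
resultant. -/
theorem discr_mul_of_natDegree_pos {R : Type*} [CommRing R] [IsDomain R] [CharZero R] {f g : R[X]}
    (hf : 0 < f.natDegree) (hg : 0 < g.natDegree) :
    (f * g).discr = f.discr * g.discr * resultant f g ^ 2 := by
  have hf0 : f ≠ 0 := by rintro rfl; simp at hf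
  have hg0 : g ≠ 0 := by rintro rfl; simp at hg
  have hfg : (f * g).natDegree = f.natDegree + g.natDegree := natDegree_mul hf0 hg0
  have key : ∀ p q : R[X], 0 < p.natDegree → 0 < q.natDegree →
      resultant p (derivative p * q + p * derivative q) p.natDegree
        (p.natDegree + q.natDegree - 1) =
      (-1) ^ (p.natDegree * (p.natDegree - 1) / 2) * p.leadingCoeff * p.discr * resultant p q := by
    intro p q hp hq
    rw [resultant_add_mul_right _ _ _ _ _ (by rw [natDegree_derivative]; lia) le_rfl,
      show p.natDegree + q.natDegree - 1 = (derivative p).natDegree + q.natDegree by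
        rw [natDegree_derivative]; lia,
      resultant_mul_right _ _ _ _ le_rfl, natDegree_derivative,
      resultant_deriv (natDegree_pos_iff_degree_pos.1 hp)]
  have h := resultant_deriv (f := f * g) (natDegree_pos_iff_degree_pos.1 (by lia))
  have hn : (derivative (f * g)).natDegree ≤ f.natDegree + g.natDegree - 1 := by
    rw [natDegree_derivative, hfg]
  rw [hfg, resultant_mul_left _ _ _ _ hn, derivative_mul, key f g hf hg,
    show derivative f * g + f * derivative g = derivative g * f + g * derivative f by ring,
    add_comm f.natDegree, key g f hg hf, resultant_comm g f, leadingCoeff_mul] at h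
  have e : (g.natDegree + f.natDegree) * (g.natDegree + f.natDegree - 1) / 2 =
      f.natDegree * (f.natDegree - 1) / 2 + g.natDegree * (g.natDegree - 1) / 2 +
        g.natDegree * f.natDegree := by
    obtain ⟨m, hm⟩ := Nat.exists_eq_add_of_lt hf
    obtain ⟨n, hn⟩ := Nat.exists_eq_add_of_lt hg
    rw [hm, hn]
    simp only [zero_add, Nat.add_sub_cancel]
    obtain ⟨x, hx⟩ := (Nat.even_mul_succ_self m).two_dvd
    obtain ⟨y, hy⟩ := (Nat.even_mul_succ_self n).two_dvd
    have h1 : (n + 1 + (m + 1)) * (n + 1 + (m + 1) - 1) =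
        2 * (x + y + (n + 1) * (m + 1)) := by
      rw [show n + 1 + (m + 1) - 1 = n + m + 1 by lia]
      linear_combination hx + hy
    rw [h1, mul_comm (m + 1) m, mul_comm (n + 1) n]
    rw [hx, hy]; simp
  rw [e] at h
  have hne : (-1 : R) ^ (f.natDegree * (f.natDegree - 1) / 2 + g.natDegree * (g.natDegree - 1) / 2 +
        g.natDegree * f.natDegree) * (f.leadingCoeff * g.leadingCoeff) ≠ 0 := by
    simp [hf0, hg0]
  refine mul_left_cancel₀ hne ?_
  rw [← h]
  ring

section
variable {K : Type*} [Field K]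

theorem natDegree_cubicF (a b : K) : (cubicF a b).natDegree = 3 := by
  unfold cubicF; compute_degree!

theorem natDegree_cubicG [CharZero K] (b : K) : (cubicG b).natDegree = 3 := by
  unfold cubicG; compute_degree!

theorem cubicF_coeff (a b : K) : (cubicF a b).coeff 0 = 1 ∧ (cubicF a b).coeff 1 = b ∧
    (cubicF a b).coeff 2 = a ∧ (cubicF a b).coeff 3 = 1 := by
  simp [cubicF, coeff_X, coeff_one, coeff_X_pow]

theorem cubicG_coeff (b : K) : (cubicG b).coeff 0 = 1 ∧ (cubicG b).coeff 1 = 2 * b ∧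
    (cubicG b).coeff 2 = b ^ 2 ∧ (cubicG b).coeff 3 = 4 := by
  simp [cubicG, coeff_X, coeff_one, coeff_X_pow, -map_mul, -map_pow]

theorem discr_cubicF (a b : K) :
    (cubicF a b).discr = a ^ 2 * b ^ 2 - 4 * b ^ 3 - 4 * a ^ 3 - 27 + 18 * a * b := by
  obtain ⟨h0, h1, h2, h3⟩ := cubicF_coeff a b
  rw [discr_of_degree_eq_three, h0, h1, h2, h3]
  · ring
  · exact (degree_eq_iff_natDegree_eq_of_pos (by norm_num)).2 (natDegree_cubicF a b)

theorem discr_cubicG [CharZero K] (b : K) : (cubicG b).discr = 16 * (b ^ 3 - 27) := by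
  obtain ⟨h0, h1, h2, h3⟩ := cubicG_coeff b
  rw [discr_of_degree_eq_three, h0, h1, h2, h3]
  · ring
  · exact (degree_eq_iff_natDegree_eq_of_pos (by norm_num)).2 (natDegree_cubicG b)

theorem cubicH_cubicF_cubicG [CharZero K] (a b : K) :
    cubicH (cubicF a b) (cubicG b) = (b ^ 3 - 2 * (a * b) - 9) / 3 := by
  obtain ⟨h0, h1, h2, h3⟩ := cubicF_coeff a b
  obtain ⟨g0, g1, g2, g3⟩ := cubicG_coeff b
  rw [cubicH, h0, h1, h2, h3, g0, g1, g2, g3]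
  field_simp
  ring

theorem coeff_cubicF_mul_cubicG (a b : K) :
    (cubicF a b * cubicG b).coeff 0 = 1 ∧ (cubicF a b * cubicG b).coeff 1 = 3 * b ∧
    (cubicF a b * cubicG b).coeff 2 = a + 3 * b ^ 2 ∧
    (cubicF a b * cubicG b).coeff 3 = 5 + 2 * a * b + b ^ 3 ∧
    (cubicF a b * cubicG b).coeff 4 = 6 * b + a * b ^ 2 ∧
    (cubicF a b * cubicG b).coeff 5 = 4 * a + b ^ 2 ∧
    (cubicF a b * cubicG b).coeff 6 = 4 := by
  have h : cubicF a b * cubicG b = C 4 * X ^ 6 + C (4 * a + b ^ 2) * X ^ 5 +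
      C (6 * b + a * b ^ 2) * X ^ 4 + C (5 + 2 * a * b + b ^ 3) * X ^ 3 +
      C (a + 3 * b ^ 2) * X ^ 2 + C (3 * b) * X + C 1 := by
    simp only [cubicF, cubicG, map_add, map_mul, map_pow, map_one, map_ofNat]
    ring
  rw [h]
  simp [coeff_X, coeff_one, coeff_X_pow, coeff_C, -map_mul, -map_pow, -map_add]

theorem resultant_cubicF_cubicG [CharZero K] (a b : K) :
    resultant (cubicF a b) (cubicG b) =
      a ^ 2 * b ^ 2 - 4 * b ^ 3 - 4 * a ^ 3 - 27 + 18 * a * b := by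
  obtain ⟨h0, h1, h2, h3⟩ := cubicF_coeff a b
  -- `G - 4 F` has degree at most two, which leaves a `5 × 5` determinant
  set Q : K[X] := C (b ^ 2 - 4 * a) * X ^ 2 + C (-2 * b) * X + C (-3) with hQ
  have hG : cubicG b = Q + cubicF a b * C 4 := by
    simp only [hQ, cubicF, cubicG, map_sub, map_mul, map_pow, map_ofNat, map_neg]
    ring
  have hQd : Q.natDegree ≤ 2 := by rw [hQ]; compute_degree
  rw [natDegree_cubicF, natDegree_cubicG, hG,
    resultant_add_mul_right _ _ _ _ _ (by simp) (natDegree_cubicF a b).le,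
    resultant_add_right_deg (k := 1) (n := 2) _ _ _ hQd, h3, resultant]
  have q0 : Q.coeff 0 = -3 := by simp [hQ, coeff_X]
  have q1 : Q.coeff 1 = -2 * b := by simp [hQ, coeff_C, -map_sub]
  have q2 : Q.coeff 2 = b ^ 2 - 4 * a := by simp [hQ, -map_sub]
  have : sylvester (cubicF a b) Q 3 2 =
      !![-3, 0, 0, 1, 0;
         -2 * b, -3, 0, b, 1;
         b ^ 2 - 4 * a, -2 * b, -3, a, b;
         0, b ^ 2 - 4 * a, -2 * b, 1, a;
         0, 0, b ^ 2 - 4 * a, 0, 1] := by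
    ext i j
    fin_cases i <;> fin_cases j <;>
      simp [sylvester, Fin.addCases, h0, h1, h2, h3, q0, q1, q2]
  rw [this]
  simp [Matrix.det_succ_row_zero (n := 4), Matrix.det_succ_row_zero (n := 3), Fin.succAbove,
    Matrix.det_fin_three, Finset.sum_fin_eq_sum_range, Finset.sum_range_succ]
  ring
end

/-! ### Igusa-Clebsch invariants of the product -/

section
/-! The hypotheses on `m` and `w` say that `u = 9 + m w` and `v = 27 + w` for `u = a b`,
`v = b ^ 3`. The factor `m ^ 2 (4 m - 1) w + (9 m - 2) ^ 2` is `t v w`. -/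

variable {K : Type*} [Field K]

theorem sexticJ2_cubicF_mul_cubicG {a b m w : K} (hb0 : b ≠ 0) (ha : a * b = 9 + m * w)
    (hb : b ^ 3 = 27 + w) :
    sexticJ2 (cubicF a b * cubicG b) = 2 * w ^ 2 * (4 * m ^ 2 - 12 * m + 3) := by
  obtain ⟨h0, h1, h2, h3, h4, h5, h6⟩ := coeff_cubicF_mul_cubicG a b
  obtain rfl : w = b ^ 3 - 27 := by linear_combination -hb
  obtain rfl : a = (9 + m * (b ^ 3 - 27)) / b := by rw [← ha]; field_simp
  simp only [sexticJ2, h0, h1, h2, h3, h4, h5, h6]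
  field_simp
  ring

theorem sexticJ4_cubicF_mul_cubicG {a b m w : K} (hb0 : b ≠ 0) (ha : a * b = 9 + m * w)
    (hb : b ^ 3 = 27 + w) :
    b ^ 3 * sexticJ4 (cubicF a b * cubicG b) = w ^ 3 * (4 * m ^ 4 * (w * (27 + w)) -
      12 * (2 * m + 3) * (m ^ 2 * (4 * m - 1) * w + (9 * m - 2) ^ 2)) := by
  obtain ⟨h0, h1, h2, h3, h4, h5, h6⟩ := coeff_cubicF_mul_cubicG a b
  obtain rfl : w = b ^ 3 - 27 := by linear_combination -hb
  obtain rfl : a = (9 + m * (b ^ 3 - 27)) / b := by rw [← ha]; field_simp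
  simp only [sexticJ4, h0, h1, h2, h3, h4, h5, h6]
  field_simp
  ring

theorem sexticJ6_cubicF_mul_cubicG {a b m w : K} (hb0 : b ≠ 0) (ha : a * b = 9 + m * w)
    (hb : b ^ 3 = 27 + w) :
    b ^ 6 * sexticJ6 (cubicF a b * cubicG b) = w ^ 4 *
      ((8 * m ^ 6 - 32 * m ^ 5 + 8 * m ^ 4) * (w * (27 + w)) ^ 2 +
      (-40 * m ^ 3 - 12 * m ^ 2 + 240 * m - 72) * (w * (27 + w)) *
        (m ^ 2 * (4 * m - 1) * w + (9 * m - 2) ^ 2) -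
      36 * (m ^ 2 * (4 * m - 1) * w + (9 * m - 2) ^ 2) ^ 2) := by
  obtain ⟨h0, h1, h2, h3, h4, h5, h6⟩ := coeff_cubicF_mul_cubicG a b
  obtain rfl : w = b ^ 3 - 27 := by linear_combination -hb
  obtain rfl : a = (9 + m * (b ^ 3 - 27)) / b := by rw [← ha]; field_simp
  simp only [sexticJ6, h0, h1, h2, h3, h4, h5, h6]
  field_simp
  ring
end

/-! ### Pairs of algebraically independent elements -/

section
open IntermediateField Set

variable {k E : Type*} [Field k] [Field E] [Algebra k E]

/-- Transcendence degree: if the field generated by two algebraically independent elements is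
algebraic over `k(x, y)`, then `x` and `y` are algebraically independent. -/
theorem algebraicIndependent_pair_of_isAlgebraic {u v x y : E}
    (huv : AlgebraicIndependent k ![u, v]) (htop : adjoin k {u, v} = ⊤)
    (hu : IsAlgebraic (adjoin k {x, y}) u) (hv : IsAlgebraic (adjoin k {x, y}) v) :
    AlgebraicIndependent k ![x, y] := by
  have halg : Algebra.IsAlgebraic (adjoin k {x, y}) E := by
    have hle : (⊤ : IntermediateField k E) ≤
        (algebraicClosure (adjoin k {x, y}) E).restrictScalars k := by
      rw [← htop, adjoin_le_iff]
      rintro z (rfl | rfl)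
      · exact mem_algebraicClosure_iff.2 hu
      · exact mem_algebraicClosure_iff.2 hv
    exact ⟨fun z => mem_algebraicClosure_iff.1 (hle mem_top)⟩
  have hr : range ![x, y] = {x, y} := by simp [Matrix.range_cons, Set.pair_comm]
  have halg' : Algebra.IsAlgebraic (Algebra.adjoin k (range ![x, y])) E := by
    rw [hr]
    exact ⟨fun z => isAlgebraic_adjoin_iff.1 (halg.isAlgebraic z)⟩
  exact (Algebra.IsAlgebraic.isTranscendenceBasis_of_lift_le_trdeg_of_finite k ![x, y]
    (by simpa using huv.lift_cardinalMk_le_trdeg)).1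

/-- A polynomial in two algebraically independent elements is nonzero if it is nonzero at some
point of the base field. -/
theorem AlgebraicIndependent.aeval_ne_zero_of_eval_ne_zero {x y : E}
    (hxy : AlgebraicIndependent k ![x, y]) (p : MvPolynomial (Fin 2) k) (c d : k)
    (h : MvPolynomial.eval ![c, d] p ≠ 0) : MvPolynomial.aeval ![x, y] p ≠ 0 := by
  intro h0
  rw [(algebraicIndependent_iff_injective_aeval.1 hxy).eq_iff' (map_zero _)] at h0
  simp [h0] at h

/-- Algebraically independent generators can be sent to any algebraically independent pair. -/
theorem exists_algHom_of_algebraicIndependent_pair {u v x y : E}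
    (huv : AlgebraicIndependent k ![u, v]) (htop : adjoin k {u, v} = ⊤)
    (hxy : AlgebraicIndependent k ![x, y]) : ∃ φ : E →ₐ[k] E, φ u = x ∧ φ v = y := by
  have hr : adjoin k (range ![u, v]) = ⊤ := by
    rw [← htop]; simp [Matrix.range_cons, Set.pair_comm]
  let e : FractionRing (MvPolynomial (Fin 2) k) ≃ₐ[k] E :=
    huv.aevalEquivField.trans ((equivOfEq hr).trans topEquiv)
  let ψ : FractionRing (MvPolynomial (Fin 2) k) →ₐ[k] E :=
    (val _).comp hxy.aevalEquivField.toAlgHom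
  have he : ∀ i, e (algebraMap (MvPolynomial (Fin 2) k) _ (MvPolynomial.X i)) = ![u, v] i := by
    intro i
    have := huv.aevalEquivField_algebraMap_apply_coe (MvPolynomial.X i)
    rw [MvPolynomial.aeval_X] at this
    exact this
  have hψ : ∀ i, ψ (algebraMap (MvPolynomial (Fin 2) k) _ (MvPolynomial.X i)) = ![x, y] i := by
    intro i
    have := hxy.aevalEquivField_algebraMap_apply_coe (MvPolynomial.X i)
    rw [MvPolynomial.aeval_X] at this
    exact this
  refine ⟨ψ.comp e.symm.toAlgHom, ?_, ?_⟩
  · have h0 := hψ 0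
    rw [← e.symm_apply_apply (algebraMap _ _ (MvPolynomial.X 0)), he 0] at h0
    exact h0
  · have h0 := hψ 1
    rw [← e.symm_apply_apply (algebraMap _ _ (MvPolynomial.X 1)), he 1] at h0
    exact h0
end

/-! ### Elimination and specialization -/

section
open IntermediateField

/-- A common root of two polynomials over a subfield lies in that subfield, as soon as the two
polynomials have no other common factor. -/
theorem mem_intermediateField_of_isCoprime {k K : Type*} [Field k] [Field K] [Algebra k K]
    (E : IntermediateField k K) {x : K} {p q : E[X]} {r : K[X]}
    (hp : p.map (algebraMap E K) = (X - C x) * r) (hq : aeval x q = 0)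
    (hr : IsCoprime r (q.map (algebraMap E K))) (hp0 : p ≠ 0) : x ∈ E := by
  have hpx : aeval x p = 0 := by
    rw [aeval_def, ← eval_map, hp]; simp
  have hint : IsIntegral E x := IsAlgebraic.isIntegral ⟨p, hp0, hpx⟩
  have h1 : (minpoly E x).map (algebraMap E K) ∣ (X - C x) * r :=
    hp ▸ Polynomial.map_dvd _ (minpoly.dvd E x hpx)
  have h2 : (minpoly E x).map (algebraMap E K) ∣ q.map (algebraMap E K) :=
    Polynomial.map_dvd _ (minpoly.dvd E x hq)
  have h3 := (hr.symm.of_isCoprime_of_dvd_left h2).dvd_of_dvd_mul_right h1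
  have h4 := natDegree_le_of_dvd h3 (X_sub_C_ne_zero x)
  rw [natDegree_map, natDegree_X_sub_C] at h4
  have h5 := minpoly.natDegree_eq_one_iff.1 (le_antisymm h4 (minpoly.natDegree_pos hint))
  obtain ⟨y, rfl⟩ := h5
  exact y.2

/-- Coprimality may be tested after a specialization that preserves degrees: the resultant is a
polynomial in the coefficients. -/
theorem isCoprime_map_of_isCoprime_map {R K k : Type*} [CommRing R] [Field K] [Field k]
    {ι : R →+* K} (hι : Function.Injective ι) (φ : R →+* k) {f g : R[X]}
    (hf : f.natDegree ≤ (f.map φ).natDegree) (hg : g.natDegree ≤ (g.map φ).natDegree)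
    (hfg : IsCoprime (f.map φ) (g.map φ)) (hf0 : f ≠ 0) :
    IsCoprime (f.map ι) (g.map ι) := by
  have h := resultant_ne_zero _ _ hfg
  rw [le_antisymm natDegree_map_le hf, le_antisymm natDegree_map_le hg, resultant_map_map] at h
  by_contra hc
  have h0 : resultant (f.map ι) (g.map ι) = 0 :=
    resultant_eq_zero_iff.2 ⟨.inl ((Polynomial.map_ne_zero_iff hι).2 hf0), hc⟩
  rw [natDegree_map_eq_of_injective hι, natDegree_map_eq_of_injective hι, resultant_map_map,
    map_eq_zero_iff ι hι] at h0
  exact h (by rw [h0, map_zero])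
end

section
variable {R S : Type*} [CommRing R] [CommRing S]

/-- Up to a factor, the invariant `J₂`, in the coordinates `m`, `t`. -/
def invQ (m : R) : R := 4 * m ^ 2 - 12 * m + 3

/-- Up to a factor, the invariant `J₄`. -/
def invA (m t : R) : R := m ^ 4 - 3 * (2 * m + 3) * t

/-- Up to a factor, the invariant `J₂ J₄ - 3 J₆`. -/
def invB (m t : R) : R := 2 * m ^ 6 - 18 * m ^ 3 * t + 81 * m ^ 2 * t + 27 * t ^ 2

/-- With `q = invQ m`, `e₁ = A / q ^ 2`, `e₂ = B / q ^ 3`, the result of eliminating `t` from the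
equations for `e₁`, `e₂`, multiplied by `q ^ 4`. -/
noncomputable def elimP (q A B : R) : R[X] :=
  3 * C A ^ 2 * invQ X ^ 4 - C (B * q) * invQ X ^ 3 * (2 * X + 3) ^ 2 +
    C (A * q ^ 2) * invQ X ^ 2 * X ^ 2 * (6 * X ^ 2 - 36 * X - 81) +
    C q ^ 4 * X ^ 6 * (-X ^ 2 + 60 * X + 99)

/-- With `q = invQ m`, `e₁ = A / q ^ 2`, `e₃ = D / q ^ 5`, the result of eliminating `t` from the
equations for `e₁`, `e₃`, multiplied by `q ^ 6`. -/
noncomputable def elimS (q A D : R) : R[X] :=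
  (C q ^ 2 * X ^ 4 - C A * invQ X ^ 2) ^ 3 - 27 * (2 * X + 3) ^ 3 * C (D * q) * invQ X ^ 5

theorem elimP_map (φ : R →+* S) (q A B : R) :
    (elimP q A B).map φ = elimP (φ q) (φ A) (φ B) := by
  simp [elimP, invQ]

theorem elimS_map (φ : R →+* S) (q A D : R) :
    (elimS q A D).map φ = elimS (φ q) (φ A) (φ D) := by
  simp [elimS, invQ]

theorem map_invQ (φ : R →+* S) (m : R) : φ (invQ m) = invQ (φ m) := by simp [invQ, map_ofNat]
theorem map_invA (φ : R →+* S) (m t : R) : φ (invA m t) = invA (φ m) (φ t) := by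
  simp [invA, map_ofNat]
theorem map_invB (φ : R →+* S) (m t : R) : φ (invB m t) = invB (φ m) (φ t) := by
  simp [invB, map_ofNat]

theorem eval_elimP (x q A B : R) : (elimP q A B).eval x =
    3 * A ^ 2 * invQ x ^ 4 - B * q * invQ x ^ 3 * (2 * x + 3) ^ 2 +
    A * q ^ 2 * invQ x ^ 2 * x ^ 2 * (6 * x ^ 2 - 36 * x - 81) +
    q ^ 4 * x ^ 6 * (-x ^ 2 + 60 * x + 99) := by
  simp [elimP, invQ]

theorem eval_elimS (x q A D : R) : (elimS q A D).eval x =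
    (q ^ 2 * x ^ 4 - A * invQ x ^ 2) ^ 3 - 27 * (2 * x + 3) ^ 3 * (D * q) * invQ x ^ 5 := by
  simp [elimS, invQ]

theorem isRoot_elimP (m t : R) : (elimP (invQ m) (invA m t) (invB m t)).IsRoot m := by
  rw [IsRoot, eval_elimP, invA, invB]; ring

theorem isRoot_elimS (m t : R) : (elimS (invQ m) (invA m t) (t ^ 3)).IsRoot m := by
  rw [IsRoot, eval_elimS, invA]; ring

/-- Up to a power of `q`, the coefficients of `elimP` are polynomials in the absolute invariants. -/
theorem elimP_mul (q e₁ e₂ : R) :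
    elimP q (e₁ * q ^ 2) (e₂ * q ^ 3) = C q ^ 4 * elimP 1 e₁ e₂ := by
  simp only [elimP, map_mul, map_pow, map_one]; ring

/-- Up to a power of `q`, the coefficients of `elimS` are polynomials in the absolute invariants. -/
theorem elimS_mul (q e₁ e₃ : R) :
    elimS q (e₁ * q ^ 2) (e₃ * q ^ 5) = C q ^ 6 * elimS 1 e₁ e₃ := by
  simp only [elimS, map_mul, map_pow, map_one]; ring

theorem natDegree_elimP_le (q A B : R) : (elimP q A B).natDegree ≤ 8 := by
  unfold elimP invQ; compute_degree

theorem natDegree_elimS_le (q A D : R) : (elimS q A D).natDegree ≤ 13 := by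
  unfold elimS invQ; compute_degree
end

/-! ### Recovering the coordinates from the absolute invariants -/

section
open IntermediateField

/-- At `m = -1`, `t = 1 / 3` the only common root of the two eliminants is `-1`, and it is a simple
root of the first. -/
theorem isCoprime_specialization {k : Type*} [Field k] [IsAlgClosed k] [CharZero k] {r : k[X]}
    (hr : elimP (invQ (-1 : k)) (invA (-1) (1 / 3)) (invB (-1) (1 / 3)) = (X - C (-1)) * r) :
    IsCoprime r (elimS (invQ (-1 : k)) (invA (-1) (1 / 3)) ((1 / 3) ^ 3)) := by
  have hQ : invQ (-1 : k) = 19 := by norm_num [invQ]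
  have hA : invA (-1 : k) (1 / 3) = 0 := by norm_num [invA]
  have hB : invB (-1 : k) (1 / 3) = 38 := by norm_num [invB]
  rw [hQ, hA, hB] at hr
  rw [hQ, hA]
  -- the value of `r` at `-1` is the derivative of the first eliminant there
  have hr1 : r.eval (-1) ≠ 0 := by
    have h := congrArg (fun p => (derivative p).eval (-1)) hr
    simp [elimP, invQ, derivative_pow] at h
    rw [← h]; norm_num
  rw [isCoprime_iff_aeval_ne_zero_of_isAlgClosed k k]
  intro x
  by_contra! h
  obtain ⟨h1, h2⟩ := h
  rw [coe_aeval_eq_eval] at h1 h2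
  have h3 := congrArg (eval x) hr
  rw [eval_mul, h1, mul_zero, eval_elimP] at h3
  rw [eval_elimS] at h2
  have e1 : 2 * invQ x ^ 3 * (2 * x + 3) ^ 2 = 361 * x ^ 6 * (-x ^ 2 + 60 * x + 99) := by
    linear_combination (-1 / 361 : k) * h3
  have e2 : 19 ^ 5 * x ^ 12 = (2 * x + 3) ^ 3 * invQ x ^ 5 := by
    linear_combination (1 / 19 : k) * h2
  -- eliminating `x ^ 12` between `e1 ^ 2` and `e2` leaves an equation of degree four with root `-1`
  have e3 : (invQ x ^ 5 * (2 * x + 3) ^ 3) *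
      (76 * invQ x * (2 * x + 3) - (-x ^ 2 + 60 * x + 99) ^ 2) = 0 := by
    linear_combination 19 * (2 * invQ x ^ 3 * (2 * x + 3) ^ 2 +
      361 * x ^ 6 * (-x ^ 2 + 60 * x + 99)) * e1 + (-x ^ 2 + 60 * x + 99) ^ 2 * e2
  rcases mul_eq_zero.1 e3 with e4 | e4
  · have hx : x = 0 := by
      rw [mul_comm, ← e2] at e4
      simpa using e4
    subst hx
    norm_num [invQ] at e4
  · have e5 : (x + 1) * (x ^ 3 - 729 * x ^ 2 + 5043 * x + 9117) = 0 := by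
      rw [invQ] at e4; linear_combination -e4
    rcases mul_eq_zero.1 e5 with e6 | e6
    · rw [eq_neg_of_add_eq_zero_left e6] at h1
      exact hr1 h1
    · -- the cofactors come from the extended Euclidean algorithm
      have e7 : (5647544445765650790858199878240 : k) = 0 := by
        rw [invQ] at e1
        linear_combination
          (628130850889268722492060578 - 441053906151899421321592698 * x
            + 621518883803231622743854962 * x ^ 2 - 694555015979161892758238730 * x ^ 3
            + 158503150098602979121387890 * x ^ 4 + 140313048527865168266554422 * x ^ 5
            - 691401826072274768726755239 * x ^ 6 + 23187947344258316617808487 * x ^ 7) * e6 +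
          (-162807658007843934366083151 + 19402638353131483349226498 * x
            - 26561222616561645610319 * x ^ 2) * e1
      norm_num at e7

theorem le_natDegree_specialization {k : Type*} [Field k] [CharZero k] :
    8 ≤ (elimP (invQ (-1 : k)) (invA (-1) (1 / 3)) (invB (-1) (1 / 3))).natDegree ∧
    13 ≤ (elimS (invQ (-1 : k)) (invA (-1) (1 / 3)) ((1 / 3) ^ 3)).natDegree := by
  have hQ : invQ (-1 : k) = 19 := by norm_num [invQ]
  have hA : invA (-1 : k) (1 / 3) = 0 := by norm_num [invA]
  have hB : invB (-1 : k) (1 / 3) = 38 := by norm_num [invB]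
  rw [hQ, hA, hB]
  have h1 : (elimP (19 : k) 0 38).natDegree = 8 := by unfold elimP invQ; compute_degree!
  have h2 : (elimS (19 : k) 0 ((1 / 3) ^ 3)).natDegree = 13 := by
    unfold elimS invQ; compute_degree!
  exact ⟨h1.ge, h2.ge⟩

/-- The absolute invariants determine `m` and `t`: by specialization, `m` is the only common root of
the two eliminants, whose coefficients are polynomials in the invariants, and then `t` is obtained
from the first invariant, in which it is linear. -/
theorem mem_adjoin_absInv {k K : Type*} [Field k] [IsAlgClosed k] [CharZero k] [Field K]
    [Algebra k K] {m t : K} (h : AlgebraicIndependent k ![m, t]) (hQ : invQ m ≠ 0)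
    (hl : 2 * m + 3 ≠ 0) (E : IntermediateField k K) (h1 : invA m t / invQ m ^ 2 ∈ E)
    (h2 : invB m t / invQ m ^ 3 ∈ E) (h3 : t ^ 3 / invQ m ^ 5 ∈ E) : m ∈ E ∧ t ∈ E := by
  have := charZero_of_injective_algebraMap (algebraMap k K).injective
  have hm : m ∈ E := by
    set e1 : E := ⟨_, h1⟩ with he1
    set e2 : E := ⟨_, h2⟩ with he2
    set e3 : E := ⟨_, h3⟩ with he3
    let M : MvPolynomial (Fin 2) k := MvPolynomial.X 0
    let T : MvPolynomial (Fin 2) k := MvPolynomial.X 1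
    let ι : MvPolynomial (Fin 2) k →+* K := (MvPolynomial.aeval ![m, t]).toRingHom
    have hι : Function.Injective ι := algebraicIndependent_iff_injective_aeval.1 h
    have hιM : ι M = m := by simp [ι, M]
    have hιT : ι T = t := by simp [ι, T]
    let φ : MvPolynomial (Fin 2) k →+* k := MvPolynomial.eval ![-1, 1 / 3]
    have hφM : φ M = -1 := by simp [φ, M]
    have hφT : φ T = 1 / 3 := by simp [φ, T]
    -- the specialization at `m = -1`, `t = 1 / 3`, where the invariant `A` vanishes
    obtain ⟨r, hr⟩ := dvd_iff_isRoot.2 (isRoot_elimP M T)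
    have hrφ := congrArg (Polynomial.map φ) hr
    have hrι := congrArg (Polynomial.map ι) hr
    rw [elimP_map, map_invQ, map_invA, map_invB, hφM, hφT, Polynomial.map_mul, Polynomial.map_sub,
      map_X, map_C, hφM] at hrφ
    rw [elimP_map, map_invQ, map_invA, map_invB, hιM, hιT, Polynomial.map_mul, Polynomial.map_sub,
      map_X, map_C, hιM] at hrι
    have hcop := isCoprime_specialization hrφ
    obtain ⟨d1, d2⟩ := le_natDegree_specialization (k := k)
    have hmapS : (elimS (invQ M) (invA M T) (T ^ 3)).map φ =
        elimS (invQ (-1 : k)) (invA (-1) (1 / 3)) ((1 / 3) ^ 3) := by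
      rw [elimS_map, map_invQ, map_invA, map_pow, hφM, hφT]
    have hr0 : r ≠ 0 := by
      rintro rfl
      rw [Polynomial.map_zero, mul_zero] at hrφ
      rw [hrφ] at d1
      simp at d1
    have hrφ0 : r.map φ ≠ 0 := by
      intro h0
      rw [h0, mul_zero] at hrφ
      rw [hrφ] at d1
      simp at d1
    have hdeg : r.natDegree ≤ (r.map φ).natDegree := by
      rw [hrφ, natDegree_mul (X_sub_C_ne_zero _) hrφ0, natDegree_X_sub_C] at d1
      have := natDegree_elimP_le (invQ M) (invA M T) (invB M T)
      rw [hr, (monic_X_sub_C _).natDegree_mul' hr0, natDegree_X_sub_C] at this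
      omega
    have hcopK := isCoprime_map_of_isCoprime_map hι φ (f := r)
      (g := elimS (invQ M) (invA M T) (T ^ 3)) hdeg
      (by rw [hmapS]; exact (natDegree_elimS_le _ _ _).trans d2) (by rwa [hmapS]) hr0
    have hA : invA m t = (e1 : K) * invQ m ^ 2 := by simp [he1, hQ]
    have hB : invB m t = (e2 : K) * invQ m ^ 3 := by simp [he2, hQ]
    have hD : t ^ 3 = (e3 : K) * invQ m ^ 5 := by simp [he3, hQ]
    have hP : (elimP 1 e1 e2).map (algebraMap E K) = elimP 1 (e1 : K) (e2 : K) := by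
      rw [elimP_map, map_one]; rfl
    have hS : (elimS 1 e1 e3).map (algebraMap E K) = elimS 1 (e1 : K) (e3 : K) := by
      rw [elimS_map, map_one]; rfl
    have hCQ : IsUnit (C (invQ m)) := isUnit_C.2 hQ.isUnit
    rw [hA, hB, elimP_mul] at hrι
    rw [elimS_map, map_invQ, map_invA, map_pow, hιM, hιT, hA, hD, elimS_mul,
      isCoprime_mul_unit_left_right (hCQ.pow 6), ← hS] at hcopK
    refine mem_intermediateField_of_isCoprime E (p := elimP 1 e1 e2) (q := elimS 1 e1 e3)
      (r := C (invQ m)⁻¹ ^ 4 * r.map ι) ?_ ?_ ?_ ?_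
    · rw [hP, mul_left_comm, ← hrι, ← mul_assoc, ← mul_pow, ← C_mul, inv_mul_cancel₀ hQ]
      simp
    · have := isRoot_elimS m t
      rw [hA, hD, elimS_mul, IsRoot, eval_mul, ← C_pow, eval_C] at this
      rw [aeval_def, ← eval_map, hS]
      exact (mul_eq_zero.1 this).resolve_left (pow_ne_zero _ hQ)
    · rwa [isCoprime_mul_unit_left_left ((isUnit_C.2 (inv_ne_zero hQ).isUnit).pow 4)]
    · intro h0
      rw [← hP, h0, Polynomial.map_zero, mul_zero] at hrι
      have := mul_eq_zero.1 hrι.symm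
      exact this.elim (X_sub_C_ne_zero _) ((Polynomial.map_ne_zero_iff hι).2 hr0)
  refine ⟨hm, ?_⟩
  have hn : ∀ n : ℕ, (n : K) ∈ E := IntermediateField.natCast_mem E
  have hqE : invQ m ∈ E :=
    add_mem (sub_mem (mul_mem (hn 4) (pow_mem hm 2)) (mul_mem (hn 12) hm)) (hn 3)
  have ht : t = (m ^ 4 - invA m t / invQ m ^ 2 * invQ m ^ 2) / (3 * (2 * m + 3)) := by
    rw [div_mul_cancel₀ _ (pow_ne_zero 2 hQ), invA, eq_div_iff (mul_ne_zero three_ne_zero hl)]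
    ring
  rw [ht]
  exact div_mem (sub_mem (pow_mem hm 4) (mul_mem h1 (pow_mem hqE 2)))
    (mul_mem (hn 3) (add_mem (mul_mem (hn 2) hm) (hn 3)))
end

/-! ### The invariants in the coordinates `m`, `t` -/

section
open IntermediateField
variable {K : Type*} [Field K]

/-- The linear form `m ^ 2 (4 m - 1) w + (9 m - 2) ^ 2` in `w`, whose product with `w ^ 2` is the
denominator of `nuV u v` for `u = 9 + m w`, `v = 27 + w`. -/
def linL (m w : K) : K := m ^ 2 * (4 * m - 1) * w + (9 * m - 2) ^ 2

theorem denominator_eq_sq_mul_linL (m w : K) :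
    4 * (9 + m * w) ^ 3 + 27 * (27 + w) - 18 * (9 + m * w) * (27 + w) -
      (9 + m * w) ^ 2 * (27 + w) + 4 * (27 + w) ^ 2 = w ^ 2 * linL m w := by
  rw [linL]; ring

section
variable {a b m w t : K} (hb0 : b ≠ 0) (ha : a * b = 9 + m * w) (hb : b ^ 3 = 27 + w)
  (ht : t * (w * (27 + w)) = linL m w)
include hb0 ha hb ht

theorem discr_cubicF_eq_neg : (cubicF a b).discr = -(w ^ 3 * t) := by
  rw [discr_cubicF]
  have h3 : b ^ 3 ≠ 0 := pow_ne_zero 3 hb0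
  refine mul_left_cancel₀ h3 ?_
  have e : b ^ 3 * (a ^ 2 * b ^ 2 - 4 * b ^ 3 - 4 * a ^ 3 - 27 + 18 * a * b) =
      -(4 * (a * b) ^ 3 + 27 * b ^ 3 - 18 * (a * b) * b ^ 3 - (a * b) ^ 2 * b ^ 3 +
        4 * (b ^ 3) ^ 2) := by ring
  rw [e, ha, hb, denominator_eq_sq_mul_linL, ← ht]
  ring

/-- The resultant of the two cubics equals the discriminant of the first. -/
theorem resultant_cubicF_cubicG_eq_neg [CharZero K] :
    resultant (cubicF a b) (cubicG b) = -(w ^ 3 * t) := by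
  rw [resultant_cubicF_cubicG, ← discr_cubicF, discr_cubicF_eq_neg hb0 ha hb ht]

omit hb0 ha ht in
theorem discr_cubicG_eq [CharZero K] : (cubicG b).discr = 16 * w := by
  rw [discr_cubicG, hb]; ring

omit hb0 ht in
theorem cubicH_eq [CharZero K] : cubicH (cubicF a b) (cubicG b) = w * (1 - 2 * m) / 3 := by
  rw [cubicH_cubicF_cubicG, ha, hb]; ring

theorem sexticJ4_eq (hv : 27 + w ≠ 0) :
    sexticJ4 (cubicF a b * cubicG b) = 4 * w ^ 4 * invA m t := by
  have h := sexticJ4_cubicF_mul_cubicG hb0 ha hb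
  rw [← linL, ← ht, hb] at h
  refine mul_left_cancel₀ hv (h.trans ?_)
  rw [invA]; ring

/-- The combination in `absInv2`, in which most terms of `J₂ J₄` and `3 J₆` cancel. -/
theorem sexticJ2_mul_sexticJ4_sub (hv : 27 + w ≠ 0) :
    sexticJ2 (cubicF a b * cubicG b) * sexticJ4 (cubicF a b * cubicG b) -
      3 * sexticJ6 (cubicF a b * cubicG b) = 4 * w ^ 6 * invB m t := by
  have h := sexticJ6_cubicF_mul_cubicG hb0 ha hb
  rw [← linL, ← ht, show b ^ 6 = (b ^ 3) ^ 2 by ring, hb] at h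
  rw [sexticJ4_eq hb0 ha hb ht hv, sexticJ2_cubicF_mul_cubicG hb0 ha hb]
  refine mul_left_cancel₀ (pow_ne_zero 2 hv) ?_
  rw [mul_sub, mul_left_comm _ 3, h, invA, invB]
  ring

theorem sexticJ10_eq [CharZero K] :
    sexticJ10 (cubicF a b * cubicG b) = -16 * w ^ 10 * t ^ 3 := by
  rw [sexticJ10, discr_mul_of_natDegree_pos (by rw [natDegree_cubicF]; norm_num)
    (by rw [natDegree_cubicG]; norm_num), discr_cubicF_eq_neg hb0 ha hb ht, discr_cubicG_eq hb,
    resultant_cubicF_cubicG_eq_neg hb0 ha hb ht]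
  ring

theorem absInv1_eq [CharZero K] (hw : w ≠ 0) (hv : 27 + w ≠ 0) (hQ : invQ m ≠ 0) :
    absInv1 (cubicF a b * cubicG b) = 144 * (invA m t / invQ m ^ 2) := by
  rw [absInv1, sexticJ4_eq hb0 ha hb ht hv, sexticJ2_cubicF_mul_cubicG hb0 ha hb, ← invQ]
  field_simp
  ring

theorem absInv2_eq [CharZero K] (hw : w ≠ 0) (hv : 27 + w ≠ 0) (hQ : invQ m ≠ 0) :
    absInv2 (cubicF a b * cubicG b) = -864 * (invB m t / invQ m ^ 3) := by
  rw [absInv2, sexticJ2_mul_sexticJ4_sub hb0 ha hb ht hv,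
    sexticJ2_cubicF_mul_cubicG hb0 ha hb, ← invQ]
  field_simp
  ring

theorem absInv3_eq [CharZero K] (hw : w ≠ 0) (hQ : invQ m ≠ 0) :
    absInv3 (cubicF a b * cubicG b) = -243 * (t ^ 3 / invQ m ^ 5) := by
  rw [absInv3, sexticJ10_eq hb0 ha hb ht, sexticJ2_cubicF_mul_cubicG hb0 ha hb, ← invQ]
  field_simp
  ring

theorem cubicR1_eq [CharZero K] (hw : w ≠ 0) (ht0 : t ≠ 0) :
    cubicR1 (cubicF a b) (cubicG b) = -((1 - 2 * m) ^ 3 / (27 * t)) := by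
  rw [cubicR1, cubicH_eq ha hb, resultant_cubicF_cubicG_eq_neg hb0 ha hb ht]
  field_simp
  ring

theorem cubicR2_eq [CharZero K] (hw : w ≠ 0) (ht0 : t ≠ 0) :
    cubicR2 (cubicF a b) (cubicG b) = -((1 - 2 * m) ^ 4 / (1296 * t)) := by
  rw [cubicR2, cubicH_eq ha hb, discr_cubicF_eq_neg hb0 ha hb ht, discr_cubicG_eq hb]
  field_simp
  ring

/-- The ratio `r₂ / r₁ = (1 - 2 m) / 48` gives `m`, and then `r₁` gives `t`. -/
theorem fieldR_eq_adjoin {k : Type*} [Field k] [CharZero k] [Algebra k K] (hw : w ≠ 0)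
    (ht0 : t ≠ 0) (hm : 1 - 2 * m ≠ 0) :
    fieldR k (cubicF a b) (cubicG b) = adjoin k {m, t} := by
  have := charZero_of_injective_algebraMap (algebraMap k K).injective
  have r1 := cubicR1_eq hb0 ha hb ht hw ht0
  have r2 := cubicR2_eq hb0 ha hb ht hw ht0
  have hn : ∀ (S : IntermediateField k K) (n : ℕ), (n : K) ∈ S :=
    fun S n => IntermediateField.natCast_mem S n
  apply le_antisymm
  · have hmS : m ∈ adjoin k {m, t} := subset_adjoin k _ (by simp)
    have htS : t ∈ adjoin k {m, t} := subset_adjoin k _ (by simp)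
    have hm1 : 1 - 2 * m ∈ adjoin k {m, t} := sub_mem (one_mem _) (mul_mem (hn _ 2) hmS)
    rw [adjoin_le_iff]
    rintro x (rfl | rfl)
    · rw [r1]; exact neg_mem (div_mem (pow_mem hm1 3) (mul_mem (hn _ 27) htS))
    · rw [r2]; exact neg_mem (div_mem (pow_mem hm1 4) (mul_mem (hn _ 1296) htS))
  · set S := fieldR k (cubicF a b) (cubicG b)
    have h1 : cubicR1 (cubicF a b) (cubicG b) ∈ S := subset_adjoin k _ (by simp)
    have h2 : cubicR2 (cubicF a b) (cubicG b) ∈ S := subset_adjoin k _ (by simp)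
    have hmS : m ∈ S := by
      have : m = (1 - 48 * (cubicR2 (cubicF a b) (cubicG b) / cubicR1 (cubicF a b) (cubicG b)))
          / 2 := by
        rw [r1, r2]; field_simp; ring
      rw [this]
      exact div_mem (sub_mem (one_mem _) (mul_mem (hn _ 48) (div_mem h2 h1))) (hn _ 2)
    have htS : t ∈ S := by
      have : t = -((1 - 2 * m) ^ 3 / (27 * cubicR1 (cubicF a b) (cubicG b))) := by
        rw [r1]; field_simp
      rw [this]
      exact neg_mem (div_mem (pow_mem (sub_mem (one_mem _) (mul_mem (hn _ 2) hmS)) 3)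
        (mul_mem (hn _ 27) h1))
    rw [adjoin_le_iff]
    rintro x (rfl | rfl)
    exacts [hmS, htS]

theorem fieldI_eq_adjoin {k : Type*} [Field k] [IsAlgClosed k] [CharZero k] [Algebra k K]
    (hmt : AlgebraicIndependent k ![m, t]) (hw : w ≠ 0) (hv : 27 + w ≠ 0) (hQ : invQ m ≠ 0)
    (hl : 2 * m + 3 ≠ 0) :
    fieldI k (cubicF a b * cubicG b) = adjoin k {m, t} := by
  have := charZero_of_injective_algebraMap (algebraMap k K).injective
  have i1 := absInv1_eq hb0 ha hb ht hw hv hQ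
  have i2 := absInv2_eq hb0 ha hb ht hw hv hQ
  have i3 := absInv3_eq hb0 ha hb ht hw hQ
  have hn : ∀ (S : IntermediateField k K) (n : ℕ), (n : K) ∈ S :=
    fun S n => IntermediateField.natCast_mem S n
  apply le_antisymm
  · let m' : adjoin k {m, t} := ⟨m, subset_adjoin k _ (by simp)⟩
    let t' : adjoin k {m, t} := ⟨t, subset_adjoin k _ (by simp)⟩
    let f := algebraMap (adjoin k {m, t}) K
    have hQ' : invQ m ∈ adjoin k {m, t} := by
      rw [show invQ m = f (invQ m') from (map_invQ f m').symm]; exact (invQ m').2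
    have hA' : invA m t ∈ adjoin k {m, t} := by
      rw [show invA m t = f (invA m' t') from (map_invA f m' t').symm]; exact (invA m' t').2
    have hB' : invB m t ∈ adjoin k {m, t} := by
      rw [show invB m t = f (invB m' t') from (map_invB f m' t').symm]; exact (invB m' t').2
    rw [adjoin_le_iff]
    rintro x (rfl | rfl | rfl)
    · rw [i1]; exact mul_mem (hn _ 144) (div_mem hA' (pow_mem hQ' 2))
    · rw [i2]; exact mul_mem (neg_mem (hn _ 864)) (div_mem hB' (pow_mem hQ' 3))
    · rw [i3]; exact mul_mem (neg_mem (hn _ 243)) (div_mem (pow_mem t'.2 3) (pow_mem hQ' 5))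
  · set S := fieldI k (cubicF a b * cubicG b)
    have h1 : invA m t / invQ m ^ 2 ∈ S := by
      have : invA m t / invQ m ^ 2 = absInv1 (cubicF a b * cubicG b) / 144 := by
        rw [i1]; field_simp
      rw [this]
      exact div_mem (subset_adjoin k _ (by simp)) (hn _ 144)
    have h2 : invB m t / invQ m ^ 3 ∈ S := by
      have : invB m t / invQ m ^ 3 = absInv2 (cubicF a b * cubicG b) / -864 := by
        rw [i2]; field_simp
      rw [this]
      exact div_mem (subset_adjoin k _ (by simp)) (neg_mem (hn _ 864))
    have h3 : t ^ 3 / invQ m ^ 5 ∈ S := by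
      have : t ^ 3 / invQ m ^ 5 = absInv3 (cubicF a b * cubicG b) / -243 := by
        rw [i3]; field_simp
      rw [this]
      exact div_mem (subset_adjoin k _ (by simp)) (neg_mem (hn _ 243))
    obtain ⟨hm, ht⟩ := mem_adjoin_absInv hmt hQ hl S h1 h2 h3
    rw [adjoin_le_iff]
    rintro x (rfl | rfl)
    exacts [hm, ht]
end
end

/-! ### The quadratic extension and its involution -/

section
open IntermediateField

/-- The image of `v = 27 + w` when `w` goes to the other root of its quadratic equation over
`k(m, t)`. -/
theorem nuV_eq {K : Type*} [Field K] {m w t : K} (hw : w ≠ 0) (hv : 27 + w ≠ 0) (hL : linL m w ≠ 0)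
    (ht : t * (w * (27 + w)) = linL m w) :
    nuV (9 + m * w) (27 + w) = 27 + -((9 * m - 2) ^ 2 / (t * w)) := by
  have htw : t * w = linL m w / (27 + w) := by rw [← ht]; field_simp
  rw [nuV, denominator_eq_sq_mul_linL, htw]
  field_simp
  rw [linL]; ring

/-- The image of `u = 9 + m w` when `m` is fixed and `w` goes to the other root of its quadratic
equation over `k(m, t)`. -/
theorem nuU_eq {K : Type*} [Field K] {m w t : K} (hw : w ≠ 0) (hv : 27 + w ≠ 0) (hL : linL m w ≠ 0)
    (ht : t * (w * (27 + w)) = linL m w) :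
    nuU (9 + m * w) (27 + w) = 9 + m * -((9 * m - 2) ^ 2 / (t * w)) := by
  have htw : t * w = linL m w / (27 + w) := by rw [← ht]; field_simp
  rw [nuU, denominator_eq_sq_mul_linL, htw, add_sub_cancel_left]
  field_simp
  rw [linL]; ring

/-- `w` and `-(9 m - 2) ^ 2 / (t w)` are the two roots of a quadratic polynomial over `k(m, t)`. -/
theorem conj_mul_eq_linL {K : Type*} [Field K] {m w t : K} (hw : w ≠ 0) (ht0 : t ≠ 0)
    (ht : t * (w * (27 + w)) = linL m w) :
    t * (-((9 * m - 2) ^ 2 / (t * w)) * (27 + -((9 * m - 2) ^ 2 / (t * w)))) =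
      linL m (-((9 * m - 2) ^ 2 / (t * w))) := by
  rw [linL] at *
  field_simp
  linear_combination -(9 * m - 2) ^ 2 * ht

variable {k E : Type*} [Field k] [Field E] [Algebra k E]

/-- The element `w` satisfies `t w ^ 2 + (27 t - m ^ 2 (4 m - 1)) w - (9 m - 2) ^ 2 = 0`. -/
theorem exists_quadratic_root_over {S : IntermediateField k E} {m w t : E} (hm : m ∈ S) (htS : t ∈ S)
    (ht0 : t ≠ 0) (ht : t * (w * (27 + w)) = linL m w) :
    ∃ p : S[X], p.natDegree = 2 ∧ aeval w p = 0 := by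
  let m' : S := ⟨m, hm⟩
  let t' : S := ⟨t, htS⟩
  have ht' : t' ≠ 0 := fun h => ht0 (congrArg Subtype.val h)
  refine ⟨C t' * X ^ 2 + C (27 * t' - m' ^ 2 * (4 * m' - 1)) * X + C (-(9 * m' - 2) ^ 2),
    by compute_degree!, ?_⟩
  simp only [map_add, map_mul, aeval_C, map_pow, aeval_X, map_neg, map_sub, map_ofNat, map_one]
  rw [show algebraMap S E t' = t from rfl, show algebraMap S E m' = m from rfl]
  rw [linL] at ht
  linear_combination ht

theorem isAlgebraic_coordinates {S : IntermediateField k E} {m w t : E} (hm : m ∈ S) (htS : t ∈ S)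
    (ht0 : t ≠ 0) (ht : t * (w * (27 + w)) = linL m w) :
    IsAlgebraic S (9 + m * w) ∧ IsAlgebraic S (27 + w) := by
  obtain ⟨p, hp, hpw⟩ := exists_quadratic_root_over hm htS ht0 ht
  have hw : IsAlgebraic S w := ⟨p, by rintro rfl; simp at hp, hpw⟩
  have hn : ∀ n : ℕ, IsAlgebraic S (n : E) := fun n => isAlgebraic_natCast n
  have hm' : IsAlgebraic S m := isAlgebraic_algebraMap (⟨m, hm⟩ : S)
  exact ⟨(hn 9).add (hm'.mul hw), (hn 27).add hw⟩

/-- The extension `k(u, v) / k(m, t)` is quadratic. The conjugation `w ↦ -(9 m - 2) ^ 2 / (t w)` is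
constructed as a `k`-endomorphism of the rational function field before `w ∉ k(m, t)` is known, and
this is deduced from it: the endomorphism fixes `m` and `t` but moves `w`. -/
theorem exists_galois_involution [CharZero k] {u v m w t : E} (huv : AlgebraicIndependent k ![u, v])
    (htop : adjoin k {u, v} = ⊤) (hu : u = 9 + m * w) (hv : v = 27 + w) (hw : w ≠ 0)
    (hv0 : v ≠ 0) (hL : linL m w ≠ 0) (ht0 : t ≠ 0) (hu' : v - 3 * u ≠ 0) (hm9 : 9 * m - 2 ≠ 0)
    (hne : nuV u v ≠ v)
    (ht : t * (w * (27 + w)) = linL m w) (L : IntermediateField k E) (hLe : L = adjoin k {m, t}) :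
    Module.finrank L E = 2 ∧ IsGalois L E ∧ ∃ ν : E ≃ₐ[L] E, ν u = nuU u v ∧ ν v = nuV u v ∧
      ν ≠ 1 ∧ ν * ν = 1 ∧ Subgroup.zpowers ν = ⊤ := by
  have := charZero_of_injective_algebraMap (algebraMap k E).injective
  subst hu hv
  set w' : E := -((9 * m - 2) ^ 2 / (t * w)) with hw'
  have hnu : nuU (9 + m * w) (27 + w) = 9 + m * w' := nuU_eq hw hv0 hL ht
  have hnv : nuV (9 + m * w) (27 + w) = 27 + w' := nuV_eq hw hv0 hL ht
  have ht' : t * (w' * (27 + w')) = linL m w' := conj_mul_eq_linL hw ht0 ht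
  have hw0' : w' ≠ 0 := neg_ne_zero.2 (div_ne_zero (pow_ne_zero 2 hm9) (mul_ne_zero ht0 hw))
  have hv0' : 27 + w' ≠ 0 := by
    rw [← hnv, nuV, denominator_eq_sq_mul_linL]
    exact div_ne_zero (neg_ne_zero.2 (mul_ne_zero (by norm_num) (pow_ne_zero 3 hu')))
      (mul_ne_zero (pow_ne_zero 2 hw) hL)
  rw [hnu, hnv]
  rw [hnv] at hne
  have hmL : m ∈ L := hLe ▸ subset_adjoin k _ (by simp)
  have htL : t ∈ L := hLe ▸ subset_adjoin k _ (by simp)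
  -- the conjugate pair is algebraically independent, since `m` and `t` are rational in it
  have hind : AlgebraicIndependent k ![9 + m * w', 27 + w'] := by
    set S := adjoin k {9 + m * w', 27 + w'} with hS
    have hn : ∀ n : ℕ, (n : E) ∈ S := fun n => IntermediateField.natCast_mem S n
    have hw'S : w' ∈ S := by
      have : w' = (27 + w') - 27 := by ring
      rw [this]
      exact sub_mem (subset_adjoin k _ (by simp)) (hn 27)
    have hmS : m ∈ S := by
      have : m = ((9 + m * w') - 9) / w' := by field_simp; ring
      rw [this]
      exact div_mem (sub_mem (subset_adjoin k _ (by simp)) (hn 9)) hw'S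
    have htS : t ∈ S := by
      have : t = (m ^ 2 * (4 * m - 1) * w' + (9 * m - 2) ^ 2) / (w' * (27 + w')) := by
        rw [← linL, ← ht']; field_simp
      rw [this]
      exact div_mem (add_mem (mul_mem (mul_mem (pow_mem hmS 2)
        (sub_mem (mul_mem (hn 4) hmS) (one_mem _))) hw'S)
        (pow_mem (sub_mem (mul_mem (hn 9) hmS) (hn 2)) 2)) (mul_mem hw'S (add_mem (hn 27) hw'S))
    obtain ⟨h1, h2⟩ := isAlgebraic_coordinates hmS htS ht0 ht
    exact algebraicIndependent_pair_of_isAlgebraic huv htop h1 h2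
  obtain ⟨φ, hφu, hφv⟩ := exists_algHom_of_algebraicIndependent_pair huv htop hind
  have hφw : φ w = w' := by
    rw [map_add, map_ofNat] at hφv
    exact add_left_cancel hφv
  have hφm : φ m = m := by
    rw [map_add, map_mul, map_ofNat, hφw] at hφu
    exact mul_right_cancel₀ hw0' (add_left_cancel hφu)
  have hφt : φ t = t := by
    have h := congrArg φ ht
    simp only [linL, map_add, map_mul, map_ofNat, hφw, map_pow, map_sub, hφm, map_one] at h
    rw [← linL, ← ht'] at h
    exact mul_right_cancel₀ (mul_ne_zero hw0' hv0') h
  have hφL : ∀ x ∈ L, φ x = x := by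
    intro x hx
    rw [hLe] at hx
    induction hx using adjoin_induction with
    | mem x hx => rcases hx with rfl | rfl <;> assumption
    | algebraMap x => exact φ.commutes x
    | add x y _ _ hx hy => rw [map_add, hx, hy]
    | inv x _ hx => rw [map_inv₀, hx]
    | mul x y _ _ hx hy => rw [map_mul, hx, hy]
  have hφw' : φ w' = w := by
    rw [hw', map_neg, map_div₀, map_pow, map_sub, map_mul, map_mul, map_ofNat, map_ofNat, hφw, hφm,
      hφt, hw']
    field_simp
  have hφφ : ∀ x, φ (φ x) = x := by
    intro x
    have hx : x ∈ adjoin k {9 + m * w, 27 + w} := htop ▸ mem_top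
    induction hx using adjoin_induction with
    | mem x hx =>
      rcases hx with rfl | rfl
      · rw [hφu, map_add, map_mul, hφm, hφw', map_ofNat]
      · rw [hφv, map_add, hφw', map_ofNat]
    | algebraMap x => rw [φ.commutes, φ.commutes]
    | add x y _ _ hx hy => rw [map_add, map_add, hx, hy]
    | inv x _ hx => rw [map_inv₀, map_inv₀, hx]
    | mul x y _ _ hx hy => rw [map_mul, map_mul, hx, hy]
  -- `φ` is the identity on `k(m, t)` and moves `w`, so the quadratic equation of `w` is irreducible
  have hwL : w ∉ L := fun h => hne (by rw [← hφw, hφL w h])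
  obtain ⟨p, hp, hpw⟩ := exists_quadratic_root_over hmL htL ht0 ht
  have hp0 : p ≠ 0 := by rintro rfl; simp at hp
  have hint : IsIntegral L w := IsAlgebraic.isIntegral ⟨p, hp0, hpw⟩
  have hdeg : (minpoly L w).natDegree = 2 := by
    refine le_antisymm (hp ▸ natDegree_le_of_dvd (minpoly.dvd L w hpw) hp0) ?_
    rw [minpoly.two_le_natDegree_iff hint]
    rintro ⟨y, hy⟩
    exact hwL (hy ▸ y.2)
  have hgen : L⟮w⟯ = ⊤ := by
    have hle : (⊤ : IntermediateField k E) ≤ L⟮w⟯.restrictScalars k := by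
      have hw1 : w ∈ L⟮w⟯ := mem_adjoin_simple_self L w
      have hm1 : m ∈ L⟮w⟯ := L⟮w⟯.algebraMap_mem ⟨m, hmL⟩
      have hn : ∀ n : ℕ, (n : E) ∈ L⟮w⟯ := fun n => IntermediateField.natCast_mem _ n
      rw [← htop, adjoin_le_iff]
      rintro x (rfl | rfl)
      · exact add_mem (hn 9) (mul_mem hm1 hw1)
      · exact add_mem (hn 27) hw1
    exact eq_top_iff.2 fun x _ => hle mem_top
  have hfin : Module.finrank L E = 2 := by
    rw [← finrank_top', ← hgen, adjoin.finrank hint, hdeg]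
  have : Algebra.IsQuadraticExtension L E := ⟨hfin⟩
  have hgal : IsGalois L E := inferInstance
  let ψ : E →ₐ[L] E := { φ with commutes' := fun x => hφL x x.2 }
  have hψψ : ψ.comp ψ = AlgHom.id L E := AlgHom.ext hφφ
  let ν : E ≃ₐ[L] E := AlgEquiv.ofAlgHom ψ ψ hψψ hψψ
  have hν1 : ν ≠ 1 := by
    intro h
    exact hne ((hφv.symm.trans (AlgEquiv.congr_fun h (27 + w))))
  have : FiniteDimensional L E := FiniteDimensional.of_finrank_pos (by rw [hfin]; norm_num)
  have : Fact (Nat.Prime 2) := ⟨Nat.prime_two⟩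
  exact ⟨hfin, hgal, ν, hφu, hφv, hν1, AlgEquiv.ext hφφ,
    zpowers_eq_top_of_prime_card ((IsGalois.card_aut_eq_finrank L E).trans hfin) hν1⟩
end

/-! ### Rational function fields in two variables -/

section
open IntermediateField

/-- The coordinates `m`, `w`, `t` attached to generators `u`, `v` of a rational function field. -/
theorem exists_coordinates {k E : Type*} [Field k] [CharZero k] [Field E] [Algebra k E] {u v : E}
    (huv : AlgebraicIndependent k ![u, v]) (htop : adjoin k {u, v} = ⊤) :
    ∃ m w t : E, u = 9 + m * w ∧ v = 27 + w ∧ t * (w * (27 + w)) = linL m w ∧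
      AlgebraicIndependent k ![m, t] ∧ w ≠ 0 ∧ v ≠ 0 ∧ linL m w ≠ 0 ∧ t ≠ 0 ∧ v - 3 * u ≠ 0 ∧
      9 * m - 2 ≠ 0 ∧ nuV u v ≠ v := by
  have := charZero_of_injective_algebraMap (algebraMap k E).injective
  let U : MvPolynomial (Fin 2) k := MvPolynomial.X 0
  let V : MvPolynomial (Fin 2) k := MvPolynomial.X 1
  -- each polynomial that must not vanish at `(u, v)` is nonzero at the point `(0, 1)`
  have key := fun p hp => huv.aeval_ne_zero_of_eval_ne_zero p 0 1 hp
  have hv : v ≠ 0 := by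
    simpa [V] using key V (by simp [V])
  have hw : v - 27 ≠ 0 := by
    simpa [V] using key (V - 27) (by simp [V]; norm_num)
  have hu : v - 3 * u ≠ 0 := by
    simpa [U, V] using key (V - 3 * U) (by simp [U, V])
  have hm : 9 * u - 2 * v - 27 ≠ 0 := by
    simpa [U, V] using key (9 * U - 2 * V - 27) (by simp [U, V]; norm_num)
  have hD : 4 * u ^ 3 + 27 * v - 18 * u * v - u ^ 2 * v + 4 * v ^ 2 ≠ 0 := by
    have h := key (4 * U ^ 3 + 27 * V - 18 * U * V - U ^ 2 * V + 4 * V ^ 2)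
      (by simp [U, V]; norm_num)
    simpa [U, V] using h
  have hne : 4 * (v - 3 * u) ^ 3 +
      v * (4 * u ^ 3 + 27 * v - 18 * u * v - u ^ 2 * v + 4 * v ^ 2) ≠ 0 := by
    have h := key (4 * (V - 3 * U) ^ 3 +
      V * (4 * U ^ 3 + 27 * V - 18 * U * V - U ^ 2 * V + 4 * V ^ 2)) (by simp [U, V]; norm_num)
    simpa [U, V] using h
  obtain ⟨w, rfl⟩ : ∃ w, v = 27 + w := ⟨v - 27, by ring⟩
  rw [add_sub_cancel_left] at hw
  obtain ⟨m, rfl⟩ : ∃ m, u = 9 + m * w := ⟨(u - 9) / w, by field_simp; ring⟩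
  have hL : linL m w ≠ 0 := by
    rw [denominator_eq_sq_mul_linL] at hD
    exact right_ne_zero_of_mul hD
  have ht : linL m w / (w * (27 + w)) * (w * (27 + w)) = linL m w := by field_simp
  have ht0 : linL m w / (w * (27 + w)) ≠ 0 := div_ne_zero hL (mul_ne_zero hw hv)
  refine ⟨m, w, linL m w / (w * (27 + w)), rfl, rfl, ht, ?_, hw, hv, hL, ht0, hu, ?_, ?_⟩
  · obtain ⟨h1, h2⟩ := isAlgebraic_coordinates (k := k)
      (S := adjoin k {m, linL m w / (w * (27 + w))})
      (subset_adjoin k _ (by simp)) (subset_adjoin k _ (by simp)) ht0 ht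
    exact algebraicIndependent_pair_of_isAlgebraic huv htop h1 h2
  · intro h
    exact hm (by linear_combination w * h)
  · intro h
    rw [nuV, div_eq_iff hD] at h
    exact hne (by linear_combination -h)
end

theorem mainTheorem8 {k K : Type*} [Field k] [IsAlgClosed k] [CharZero k] [Field K] [Algebra k K]
    (u v a b : K) (huv : AlgebraicIndependent k ![u, v]) (hu : u = a * b) (hv : v = b ^ 3) :
    (sexticJ2 (cubicF a b * cubicG b) ≠ 0 ∧ resultant (cubicF a b) (cubicG b) ≠ 0 ∧
      (cubicF a b).discr ≠ 0 ∧ (cubicG b).discr ≠ 0) ∧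
    fieldI k (cubicF a b * cubicG b) = fieldR k (cubicF a b) (cubicG b) ∧
    ∃ h : fieldR k (cubicF a b) (cubicG b) ≤ fieldUV k u v,
      Module.finrank (IntermediateField.restrict h) (fieldUV k u v) = 2 ∧
      IsGalois (IntermediateField.restrict h) (fieldUV k u v) ∧
      ∃ ν : fieldUV k u v ≃ₐ[IntermediateField.restrict h] fieldUV k u v,
        (ν (genU k u v) : K) = nuU u v ∧ (ν (genV k u v) : K) = nuV u v ∧
        ν ≠ 1 ∧ ν * ν = 1 ∧ Subgroup.zpowers ν = ⊤ := by
  have := charZero_of_injective_algebraMap (algebraMap k K).injective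
  have huvE : AlgebraicIndependent k ![genU k u v, genV k u v] := by
    refine AlgebraicIndependent.of_comp (fieldUV k u v).val ?_
    convert! huv using 1
    ext i; fin_cases i <;> rfl
  have htop : IntermediateField.adjoin k {genU k u v, genV k u v} = ⊤ := by
    apply IntermediateField.lift_injective
    rw [IntermediateField.lift_adjoin, IntermediateField.lift_top, Set.image_pair]
    rfl
  obtain ⟨m, w, t, hum, hvw, ht, hmt, hw, hv0, hL, ht0, hu3, hm9, hne⟩ :=
    exists_coordinates huvE htop
  have huK : u = 9 + (m : K) * w := congrArg Subtype.val hum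
  have hvK : v = 27 + (w : K) := congrArg Subtype.val hvw
  have htK : (t : K) * (w * (27 + w)) = linL (m : K) w := congrArg Subtype.val ht
  have hwK : (w : K) ≠ 0 := fun h => hw (Subtype.ext h)
  have htK0 : (t : K) ≠ 0 := fun h => ht0 (Subtype.ext h)
  have hvK0 : v ≠ 0 := fun h => hv0 (Subtype.ext h)
  have hmtK : AlgebraicIndependent k ![(m : K), (t : K)] := by
    have := hmt.map' (f := (fieldUV k u v).val) Subtype.val_injective
    convert! this using 1
    ext i; fin_cases i <;> rfl
  let M : MvPolynomial (Fin 2) k := MvPolynomial.X 0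
  have key := fun p hp => hmtK.aeval_ne_zero_of_eval_ne_zero p 0 0 hp
  have hQ : invQ (m : K) ≠ 0 := by
    have h := key (4 * M ^ 2 - 12 * M + 3) (by simp [M])
    simpa [M, invQ] using h
  have hl : 2 * (m : K) + 3 ≠ 0 := by
    simpa [M] using key (2 * M + 3) (by simp [M])
  have hm2 : 1 - 2 * (m : K) ≠ 0 := by
    simpa [M] using key (1 - 2 * M) (by simp [M])
  have hb0 : b ≠ 0 := by rintro rfl; exact hvK0 (by rw [hv]; simp)
  have ha : a * b = 9 + (m : K) * w := hu ▸ huK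
  have hb : b ^ 3 = 27 + (w : K) := hv ▸ hvK
  have hR := fieldR_eq_adjoin (k := k) hb0 ha hb htK hwK htK0 hm2
  have hDF : -((w : K) ^ 3 * t) ≠ 0 := neg_ne_zero.2 (mul_ne_zero (pow_ne_zero 3 hwK) htK0)
  refine ⟨⟨?_, ?_, ?_, ?_⟩, ?_, ?_⟩
  · rw [sexticJ2_cubicF_mul_cubicG hb0 ha hb]
    exact mul_ne_zero (mul_ne_zero two_ne_zero (pow_ne_zero 2 hwK)) hQ
  · rwa [resultant_cubicF_cubicG_eq_neg hb0 ha hb htK]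
  · rwa [discr_cubicF_eq_neg hb0 ha hb htK]
  · rw [discr_cubicG_eq hb]
    exact mul_ne_zero (by norm_num) hwK
  · rw [hR, fieldI_eq_adjoin hb0 ha hb htK hmtK hwK (hvK ▸ hvK0) hQ hl]
  · have h : fieldR k (cubicF a b) (cubicG b) ≤ fieldUV k u v := by
      rw [hR, IntermediateField.adjoin_le_iff]
      rintro x (rfl | rfl)
      exacts [m.2, t.2]
    have hrestr : IntermediateField.restrict h = IntermediateField.adjoin k {m, t} := by
      apply IntermediateField.lift_injective
      rw [IntermediateField.lift_restrict, IntermediateField.lift_adjoin, Set.image_pair, hR]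
    obtain ⟨hfin, hgal, ν, hνu, hνv, hν⟩ := exists_galois_involution huvE htop hum hvw hw hv0 hL
      ht0 hu3 hm9 hne ht _ hrestr
    exact ⟨h, hfin, hgal, ν, congrArg Subtype.val hνu, congrArg Subtype.val hνv, hν⟩
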